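/- For $1\le i\le N$ let $(\mathcal E_i,\mathcal D(\mathcal E_i))$ be a symmetric Dirichlet form on $L^2(\mu_i)$ (a densely defined, closed, symmetric, non-negative bilinear form that is Markovian, i.e. $f\in\mathcal D(\mathcal E_i)$ implies $(f\vee 0)\wedge 1\in\mathcal D(\mathcal E_i)$ with no larger energy) over a $\sigma$-finite measure space $(E_i,\mathcal F_i,\mu_i)$. Let $\mu=\prod_{i=1}^N\mu_i$, let $\mathcal D(\mathcal E)$ be the class of all $f\in L^2(\mu)$ such that for every $1\le i\le N$ one has $f(x,\cdot)\in\mathcal D(\mathcal E_i)$ for $\big(\prod_{j\ne i}\mu_j\big)$-a.e. $x\in\prod_{j\ne i}E_j$, and $$\sum_{i=1}^N\int_{\prod_{j\ne i}E_j}\mathcal E_i(f(x,\cdot),f(x,\cdot))\Big(\prod_{j\ne i}\mu_j\Big)(dx)<\infty,$$ and put $$\mathcal E(f,g)=\sum_{i=1}^N\int_{\prod_{j\ne i}E_j}\mathcal E_i(f(x,\cdot),g(x,\cdot))\Big(\prod_{j\ne i}\mu_j\Big)(dx),\qquad f,g\in\mathcal D(\mathcal E).$$ Let $p_1,\dots,p_N\in(0,\infty)$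 be such that for every $1\le i\le N$ the super Poincaré inequality $$\mu_i(f^2)\le r\,\mathcal E_i(f,f)+c_i\big(1+r^{-p_i}\big)\mu_i(|f|)^2,\qquad r>0,\ f\in\mathcal D(\mathcal E_i),$$ holds for some constant $c_i>0$. Then there exists a constant $c>0$ such that $$\mu(f^2)\le r\,\mathcal E(f,f)+c\big(1+r^{-\sum_{i=1}^N p_i}\big)\mu(|f|)^2,\qquad r>0,\ f\in\mathcal D(\mathcal E).$$ Here $\mu(f)=\int f\,d\mu$, and the inequalities hold trivially when $\mu_i(|f|)=\infty$, respectively $\mu(|f|)=\infty$. -/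

import Mathlib

open MeasureTheory Filter Topology

noncomputable section

/-- A symmetric Dirichlet form on `L²(μ)`: a densely defined, symmetric, nonnegative definite,
closed bilinear form on which the unit contraction `f ↦ (f ∨ 0) ∧ 1` operates. -/
structure SymmDirichletForm {Ω : Type*} [MeasurableSpace Ω] (μ : Measure Ω) where
  /-- the domain `𝒟(ℰ)` -/
  domain : Submodule ℝ (Lp ℝ 2 μ)
  dense_domain : Dense (domain : Set (Lp ℝ 2 μ))
  /-- the bilinear form `ℰ : 𝒟(ℰ) × 𝒟(ℰ) → ℝ` -/
  form : domain →ₗ[ℝ] domain →ₗ[ℝ] ℝ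
  symm : ∀ f g : domain, form f g = form g f
  nonneg : ∀ f : domain, 0 ≤ form f f
  /-- `𝒟(ℰ)` is complete for the norm `(‖f‖² + ℰ(f,f))^{1/2}`. -/
  closed : ∀ u : ℕ → domain,
    (∀ ε > 0, ∃ n₀ : ℕ, ∀ m ≥ n₀, ∀ n ≥ n₀,
      ‖(u m - u n : Lp ℝ 2 μ)‖ ^ 2 + form (u m - u n) (u m - u n) < ε) →
    ∃ v : domain,
      Tendsto (fun n => ‖(u n - v : Lp ℝ 2 μ)‖ ^ 2 + form (u n - v) (u n - v)) atTop (𝓝 0)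
  markov : ∀ f : domain, ∃ g : domain,
    ((g : Lp ℝ 2 μ) =ᵐ[μ] fun x => min (max ((f : Lp ℝ 2 μ) x) 0) 1) ∧ form g g ≤ form f f

namespace SymmDirichletForm

variable {Ω : Type*} [MeasurableSpace Ω] {μ : Measure Ω}

/-- The function `g` lies in `𝒟(ℰ)`, that is, it is square integrable and its class does. -/
def MemDomain (ℰ : SymmDirichletForm μ) (g : Ω → ℝ) : Prop :=
  ∃ h : MemLp g 2 μ, h.toLp g ∈ ℰ.domain

open Classical in
/-- The value `ℰ(g,k)` for functions `g, k` in `𝒟(ℰ)` (and `0` for other functions). -/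
def onFun (ℰ : SymmDirichletForm μ) (g k : Ω → ℝ) : ℝ :=
  if h : ℰ.MemDomain g ∧ ℰ.MemDomain k then
    ℰ.form ⟨h.1.choose.toLp g, h.1.choose_spec⟩ ⟨h.2.choose.toLp k, h.2.choose_spec⟩
  else 0

end SymmDirichletForm

/-- The super Poincaré inequality
`μ(f²) ≤ r ℰ(f,f) + β(r) μ(|f|)²` for all `r > 0` and `f ∈ 𝒟(ℰ)`, for a form `ℰ` with domain
`D ⊆ L²(μ)`. It is an inequality in `[0,∞]`, since `μ(|f|) = ∞` is possible if `μ` is infinite. -/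
def SuperPoincare {Ω : Type*} [MeasurableSpace Ω] (μ : Measure Ω) (D : Set (Lp ℝ 2 μ))
    (ℰ : D → D → ℝ) (β : ℝ → ℝ) : Prop :=
  ∀ r : ℝ, 0 < r → ∀ f : D,
    ∫⁻ x, ‖(f : Lp ℝ 2 μ) x‖ₑ ^ 2 ∂μ ≤
      ENNReal.ofReal (r * ℰ f f) +
        ENNReal.ofReal (β r) * (∫⁻ x, ‖(f : Lp ℝ 2 μ) x‖ₑ ∂μ) ^ 2

section Product

variable {ι : Type*} [Fintype ι] [DecidableEq ι] {E : ι → Type*} [∀ i, MeasurableSpace (E i)]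

/-- The section `f(x, ·) : E i → ℝ` of `f` at a point `x` of `∏_{j ≠ i} E j`. -/
def sliceAt (f : (∀ i, E i) → ℝ) (i : ι) (x : ∀ j : {j // j ≠ i}, E j) : E i → ℝ :=
  fun y => f ((Equiv.piSplitAt i E).symm (y, x))

/-- The measure `∏_{j ≠ i} μ j`. -/
def restMeasure (μ : ∀ i, Measure (E i)) (i : ι) : Measure (∀ j : {j // j ≠ i}, E j) :=
  Measure.pi fun j : {j // j ≠ i} => μ j

/-- The domain of the product form: those `f ∈ L²(∏ μ i)` such that, for every `i`, the section
`f(x, ·)` is in `𝒟(ℰ i)` for almost every `x`, and `x ↦ ℰ i (f(x, ·), f(x, ·))` has a finite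
integral. -/
def prodDomain {μ : ∀ i, Measure (E i)} (ℰ : ∀ i, SymmDirichletForm (μ i)) :
    Set (Lp ℝ 2 (Measure.pi μ)) :=
  {f | ∀ i, (∀ᵐ x ∂restMeasure μ i, (ℰ i).MemDomain (sliceAt f i x)) ∧
    Integrable (fun x => (ℰ i).onFun (sliceAt f i x) (sliceAt f i x)) (restMeasure μ i)}

/-- The product form `ℰ(f,g) = ∑ i, ∫ ℰ i (f(x, ·), g(x, ·)) (∏_{j ≠ i} μ j)(dx)`. -/
def prodForm {μ : ∀ i, Measure (E i)} (ℰ : ∀ i, SymmDirichletForm (μ i))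
    (f g : prodDomain ℰ) : ℝ :=
  ∑ i, ∫ x, (ℰ i).onFun (sliceAt (f : Lp ℝ 2 (Measure.pi μ)) i x)
    (sliceAt (g : Lp ℝ 2 (Measure.pi μ)) i x) ∂restMeasure μ i

end Product

end

open scoped ENNReal

/-! Write `ρ = f²` and `F = μ(f²)`. Outside a set carrying only a small part of the mass of `ρ`, up
to an energy term, `ρ` is at most a constant times `F`; there `∫ f² ≤ √(MF) μ(|f|)`, and the factor
`√F` is absorbed by AM-GM.

Two kinds of points are discarded for each `i`. Where `ρ` exceeds `T i` times its integral in the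
`i`-th variable, the super Poincaré inequality for the soft-thresholded section bounds the mass
(`lintegral_slice_tail_le`). Where the density of the `i`-th variable conditioned on the later
variables exceeds `K` times the density conditioned on all others, a Markov-type estimate does
(`setLIntegral_lmarginal_ratio_le`). At every remaining point, integrating out one more variable
costs a factor `K * T i`, so telescoping gives `ρ ≤ ∏ (K * T i) * F`. Since `T i` is proportional to
`β i`, the rates multiply, and the exponents `p i` add. -/

theorem lintegral_enorm_sq_Lp_ne_top {Ω : Type*} [MeasurableSpace Ω] {μ : Measure Ω}
    (f : Lp ℝ 2 μ) : ∫⁻ x, ‖f x‖ₑ ^ 2 ∂μ ≠ ∞ := by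
  simpa using (lintegral_rpow_enorm_lt_top_of_eLpNorm_lt_top (by norm_num) (by norm_num)
    (Lp.memLp f).2).ne

/-! ### Contractions and tail estimates for one Dirichlet form -/

namespace SymmDirichletForm

variable {Ω : Type*} [MeasurableSpace Ω] {μ : Measure Ω}

theorem form_add_smul_self (ℰ : SymmDirichletForm μ) (u v : ℰ.domain) (ε : ℝ) :
    ℰ.form (u + ε • v) (u + ε • v) =
      ℰ.form u u + 2 * ε * ℰ.form u v + ε ^ 2 * ℰ.form v v := by
  simp only [map_add, map_smul, LinearMap.add_apply, LinearMap.smul_apply, smul_eq_mul,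
    ℰ.symm v u]
  ring

/-- The residual of `f` after removing `(f ∨ 0) ∧ a` is in the domain, with no larger energy. -/
theorem exists_sub_clip (ℰ : SymmDirichletForm μ) (f : ℰ.domain) {a : ℝ} (ha : 0 < a) :
    ∃ g : ℰ.domain, ((g : Lp ℝ 2 μ) =ᵐ[μ] fun x =>
        (f : Lp ℝ 2 μ) x - min (max ((f : Lp ℝ 2 μ) x) 0) a) ∧
      ℰ.form g g ≤ ℰ.form f f := by
  obtain ⟨u, hu, -⟩ := ℰ.markov (a⁻¹ • f)
  have hsf : ((a⁻¹ • f : ℰ.domain) : Lp ℝ 2 μ) =ᵐ[μ] fun x => a⁻¹ * (f : Lp ℝ 2 μ) x := by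
    rw [Submodule.coe_smul]
    filter_upwards [Lp.coeFn_smul a⁻¹ (f : Lp ℝ 2 μ)] with x hx
    simpa using hx
  set h : ℰ.domain := a⁻¹ • f with hh
  -- Every point of the segment from the clip `u` towards `h` is again clipped to `u`, so the Markov
  -- property makes `u` minimal on it. The first variation `ℰ(u, h - u)` is then nonnegative, and
  -- expanding `ℰ(h, h)` gives `ℰ(h - u, h - u) ≤ ℰ(h, h)`.
  have key : ∀ ε : ℝ, 0 < ε → ε < 1 →
      ℰ.form u u ≤ ℰ.form (u + ε • (h - u)) (u + ε • (h - u)) := by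
    intro ε h0 h1
    obtain ⟨v, hv, hvle⟩ := ℰ.markov (u + ε • (h - u))
    have : v = u := by
      apply Subtype.ext
      apply Lp.ext
      have e1 : ((u + ε • (h - u) : ℰ.domain) : Lp ℝ 2 μ) =ᵐ[μ] fun x =>
          (u : Lp ℝ 2 μ) x + ε * ((h : Lp ℝ 2 μ) x - (u : Lp ℝ 2 μ) x) := by
        rw [Submodule.coe_add, Submodule.coe_smul, Submodule.coe_sub]
        filter_upwards [Lp.coeFn_add (u : Lp ℝ 2 μ) (ε • ((h : Lp ℝ 2 μ) - (u : Lp ℝ 2 μ))),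
          Lp.coeFn_smul ε ((h : Lp ℝ 2 μ) - (u : Lp ℝ 2 μ)),
          Lp.coeFn_sub (h : Lp ℝ 2 μ) u] with x h1 h2 h3
        rw [h1, Pi.add_apply, h2, Pi.smul_apply, h3, Pi.sub_apply, smul_eq_mul]
      filter_upwards [hv, e1, hu] with x h1 h2 h3
      rw [h1, h2, h3]
      generalize (h : Lp ℝ 2 μ) x = t
      rcases le_total t 0 with ht | ht
      · rw [max_eq_right ht, min_eq_left zero_le_one, max_eq_right (by nlinarith)]
        simp
      · rw [max_eq_left ht]
        rcases le_total t 1 with ht1 | ht1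
        · rw [min_eq_left ht1]; simp [ht, ht1]
        · rw [min_eq_right ht1, max_eq_left (by nlinarith), min_eq_right (by nlinarith)]
    rwa [this] at hvle
  have hcross : 0 ≤ ℰ.form u (h - u) := by
    by_contra! hneg
    have hq := ℰ.nonneg (h - u)
    set b := ℰ.form u (h - u)
    set q := ℰ.form (h - u) (h - u)
    -- This `ε` lies in `(0, 1)` and satisfies `ε * q < -b`, so the negative linear term `2 * b`
    -- would win.
    have h2 := key (-b / (q - b + 1)) (by apply div_pos <;> linarith)
      (by rw [div_lt_one (by linarith)]; linarith)
    rw [form_add_smul_self] at h2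
    have hd : 0 < q - b + 1 := by linarith
    set ε := -b / (q - b + 1) with hε
    have hεb : ε * (q - b + 1) = -b := by rw [hε]; field_simp
    have hε0 : 0 < ε := by rw [hε]; apply div_pos <;> linarith
    have h3 : 0 ≤ 2 * b + ε * q := by
      by_contra! h4
      have := mul_neg_of_pos_of_neg hε0 h4
      change ℰ.form u u ≤ ℰ.form u u + 2 * ε * b + ε ^ 2 * q at h2
      nlinarith
    nlinarith
  refine ⟨a • (h - u), ?_, ?_⟩
  · rw [Submodule.coe_smul, Submodule.coe_sub]
    filter_upwards [Lp.coeFn_smul a ((h : Lp ℝ 2 μ) - (u : Lp ℝ 2 μ)),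
      Lp.coeFn_sub (h : Lp ℝ 2 μ) u, hu, hsf]
      with x h1 h2 h3 h4
    rw [h1, Pi.smul_apply, h2, Pi.sub_apply, h3, h4, smul_eq_mul, mul_sub,
      mul_min_of_nonneg _ _ ha.le, mul_max_of_nonneg _ _ ha.le]
    field_simp
    simp
  · have hf : f = a • h := by rw [hh, smul_smul, mul_inv_cancel₀ ha.ne', one_smul]
    have h1 := form_add_smul_self ℰ u (h - u) 1
    rw [one_smul, add_sub_cancel] at h1
    rw [hf]
    simp only [map_smul, LinearMap.smul_apply, smul_eq_mul, ← mul_assoc]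
    apply mul_le_mul_of_nonneg_left _ (by positivity)
    nlinarith [ℰ.nonneg u]

/-- Soft thresholding at level `a` maps the domain to itself and does not increase the energy. -/
theorem exists_soft_threshold (ℰ : SymmDirichletForm μ) (f : ℰ.domain) {a : ℝ} (ha : 0 < a) :
    ∃ g : ℰ.domain, (∀ᵐ x ∂μ, |(g : Lp ℝ 2 μ) x| = max (|(f : Lp ℝ 2 μ) x| - a) 0) ∧
      ℰ.form g g ≤ ℰ.form f f := by
  obtain ⟨g, hg, hgf⟩ := ℰ.exists_sub_clip f ha
  obtain ⟨k, hk, hkg⟩ := ℰ.exists_sub_clip (-g) ha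
  refine ⟨k, ?_, hkg.trans (by simpa using hgf)⟩
  have hn : ((-g : ℰ.domain) : Lp ℝ 2 μ) =ᵐ[μ] -(g : Lp ℝ 2 μ) := by
    rw [Submodule.coe_neg]
    exact Lp.coeFn_neg _
  filter_upwards [hg, hk, hn] with x h1 h2 h3
  rw [h2, h3, Pi.neg_apply, h1]
  grind

/-- If the super Poincaré inequality holds, the part of `h²` above the level `T μ(h²)` has a small
integral. -/
theorem lintegral_tail_le (ℰ : SymmDirichletForm μ) {β : ℝ → ℝ}
    (hSP : SuperPoincare μ ℰ.domain (fun f g => ℰ.form f g) β) {s T : ℝ} (hs : 0 < s)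
    (hβ : 0 ≤ β s) (hT : 0 < T) (h : ℰ.domain) :
    ∫⁻ x in {x | ENNReal.ofReal T * ∫⁻ y, ‖(h : Lp ℝ 2 μ) y‖ₑ ^ 2 ∂μ < ‖(h : Lp ℝ 2 μ) x‖ₑ ^ 2},
        ‖(h : Lp ℝ 2 μ) x‖ₑ ^ 2 ∂μ ≤
      ENNReal.ofReal (4 * s * ℰ.form h h) +
        ENNReal.ofReal (16 * β s / T) * ∫⁻ y, ‖(h : Lp ℝ 2 μ) y‖ₑ ^ 2 ∂μ := by
  have hFtop : ∫⁻ y, ‖(h : Lp ℝ 2 μ) y‖ₑ ^ 2 ∂μ ≠ ∞ :=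
    lintegral_enorm_sq_Lp_ne_top _
  rcases eq_or_ne (∫⁻ y, ‖(h : Lp ℝ 2 μ) y‖ₑ ^ 2 ∂μ) 0 with h0 | h0
  · refine (setLIntegral_le_lintegral _ _).trans ?_
    rw [h0]; exact zero_le
  set F := (∫⁻ y, ‖(h : Lp ℝ 2 μ) y‖ₑ ^ 2 ∂μ).toReal with hF
  have hF0 : 0 < F := ENNReal.toReal_pos h0 hFtop
  have hFe : ∫⁻ y, ‖(h : Lp ℝ 2 μ) y‖ₑ ^ 2 ∂μ = ENNReal.ofReal F :=
    (ENNReal.ofReal_toReal hFtop).symm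
  -- On the tail set `|h| > 2a`, hence `h² ≤ 4g²` for the soft threshold `g`. Also `|g| ≤ h² / a`,
  -- so the `L¹` norm of `g` is controlled by `F` without any integrability of `h`.
  set a := √(T * F) / 2 with ha_def
  have ha : 0 < a := by positivity
  have ha2 : a ^ 2 = T * F / 4 := by
    rw [ha_def, div_pow, Real.sq_sqrt (by positivity)]; norm_num
  obtain ⟨g, hg, hgh⟩ := ℰ.exists_soft_threshold h ha
  have hsq : ∀ t : ℝ, ‖t‖ₑ ^ 2 = ENNReal.ofReal (t ^ 2) := fun t => by
    rw [← ofReal_norm, ← ENNReal.ofReal_pow (norm_nonneg _), Real.norm_eq_abs, sq_abs]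
  have hmeas : MeasurableSet {x | ENNReal.ofReal T * ∫⁻ y, ‖(h : Lp ℝ 2 μ) y‖ₑ ^ 2 ∂μ <
      ‖(h : Lp ℝ 2 μ) x‖ₑ ^ 2} :=
    measurableSet_lt measurable_const ((Lp.stronglyMeasurable _).enorm.pow_const 2)
  calc _ ≤ ∫⁻ x in {x | ENNReal.ofReal T * ∫⁻ y, ‖(h : Lp ℝ 2 μ) y‖ₑ ^ 2 ∂μ <
            ‖(h : Lp ℝ 2 μ) x‖ₑ ^ 2}, 4 * ‖(g : Lp ℝ 2 μ) x‖ₑ ^ 2 ∂μ := by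
        refine setLIntegral_mono_ae' hmeas ?_
        filter_upwards [hg] with x hx hlt
        have hlt : _ < _ := hlt
        rw [hFe, ← ENNReal.ofReal_mul hT.le, hsq, ENNReal.ofReal_lt_ofReal_iff_of_nonneg
          (by positivity)] at hlt
        have h2a : 2 * a < |(h : Lp ℝ 2 μ) x| := by
          apply lt_of_pow_lt_pow_left₀ 2 (abs_nonneg _)
          rw [sq_abs]; nlinarith
        rw [hsq, hsq, show (4 : ℝ≥0∞) = ENNReal.ofReal 4 by simp, ← ENNReal.ofReal_mul (by simp)]
        apply ENNReal.ofReal_le_ofReal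
        rw [← sq_abs ((g : Lp ℝ 2 μ) x), hx, max_eq_left (by linarith),
          ← sq_abs ((h : Lp ℝ 2 μ) x)]
        nlinarith
    _ ≤ ∫⁻ x, 4 * ‖(g : Lp ℝ 2 μ) x‖ₑ ^ 2 ∂μ := setLIntegral_le_lintegral _ _
    _ = 4 * ∫⁻ x, ‖(g : Lp ℝ 2 μ) x‖ₑ ^ 2 ∂μ := lintegral_const_mul' _ _ (by simp)
    _ ≤ 4 * (ENNReal.ofReal (s * ℰ.form g g) +
          ENNReal.ofReal (β s) * (∫⁻ x, ‖(g : Lp ℝ 2 μ) x‖ₑ ∂μ) ^ 2) := by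
        gcongr
        exact hSP s hs g
    _ ≤ 4 * (ENNReal.ofReal (s * ℰ.form h h) +
          ENNReal.ofReal (β s) * (ENNReal.ofReal (F / a)) ^ 2) := by
        gcongr
        calc ∫⁻ x, ‖(g : Lp ℝ 2 μ) x‖ₑ ∂μ
            ≤ ∫⁻ x, ENNReal.ofReal a⁻¹ * ‖(h : Lp ℝ 2 μ) x‖ₑ ^ 2 ∂μ := by
              refine lintegral_mono_ae ?_
              filter_upwards [hg] with x hx
              rw [← ofReal_norm, Real.norm_eq_abs, hx, hsq,
                ← ENNReal.ofReal_mul (by positivity)]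
              apply ENNReal.ofReal_le_ofReal
              rw [inv_mul_eq_div, le_div_iff₀ ha, ← sq_abs]
              rcases max_cases (|(h : Lp ℝ 2 μ) x| - a) 0 with ⟨h1, _⟩ | ⟨h1, _⟩ <;> rw [h1] <;>
                nlinarith [sq_nonneg (|(h : Lp ℝ 2 μ) x| - 2 * a)]
          _ = ENNReal.ofReal (F / a) := by
              rw [lintegral_const_mul' _ _ (by simp), hFe, ← ENNReal.ofReal_mul (by positivity),
                inv_mul_eq_div]
    _ = _ := by
        rw [hFe, ← ENNReal.ofReal_pow (by positivity), ← ENNReal.ofReal_mul hβ, mul_add,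
          show (4 : ℝ≥0∞) = ENNReal.ofReal 4 by simp, ← ENNReal.ofReal_mul (by simp),
          ← ENNReal.ofReal_mul (by simp), ← ENNReal.ofReal_mul (by positivity), mul_assoc 4 s,
          div_pow, ha2]
        congr 2
        field_simp
        ring

end SymmDirichletForm

/-! ### Marginals and conditional densities -/

section Marginal

variable {ι : Type*} [DecidableEq ι] {E : ι → Type*} [∀ i, MeasurableSpace (E i)]
  (μ : ∀ i, Measure (E i))

theorem lmarginal_mul_of_indep {s : Finset ι} {c f : (∀ i, E i) → ℝ≥0∞} [∀ i, SigmaFinite (μ i)]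
    (hc : ∀ x y : ∀ i, E i, (∀ i ∉ s, x i = y i) → c x = c y) (hf : Measurable f) :
    lmarginal μ s (fun x => c x * f x) = fun x => c x * lmarginal μ s f x := by
  ext x
  have : ∀ y : ∀ i : s, E i, c (Function.updateFinset x s y) = c x := fun y =>
    hc _ _ fun i hi => by simp [Function.updateFinset_def, hi]
  simp only [lmarginal, this]
  exact lintegral_const_mul _ (hf.comp measurable_updateFinset)

variable [Fintype ι] [∀ i, SigmaFinite (μ i)]

/-- The indicator of the set does not depend on the variables in `s`, so integrating these first
leaves zero. This permits division by a marginal almost everywhere with respect to `f`. -/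
theorem setLIntegral_lmarginal_eq_zero {f : (∀ i, E i) → ℝ≥0∞} (hf : Measurable f)
    (s : Finset ι) : ∫⁻ x in {x | lmarginal μ s f x = 0}, f x ∂Measure.pi μ = 0 := by
  have hm : MeasurableSet {x | lmarginal μ s f x = 0} := hf.lmarginal μ (measurableSet_singleton 0)
  set c : (∀ i, E i) → ℝ≥0∞ := {x | lmarginal μ s f x = 0}.indicator 1 with hc
  have hcm : Measurable c := measurable_one.indicator hm
  have h1 : ∫⁻ x in {x | lmarginal μ s f x = 0}, f x ∂Measure.pi μ =
      ∫⁻ x, c x * f x ∂Measure.pi μ := by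
    rw [← lintegral_indicator hm]
    congr with x
    by_cases hx : lmarginal μ s f x = 0 <;> simp [hc, hx]
  rw [h1, ← le_zero_iff, ← lintegral_zero (μ := Measure.pi μ)]
  refine lintegral_le_of_lmarginal_le s (hcm.mul hf) measurable_const ?_
  rw [lmarginal_mul_of_indep μ _ hf]
  · intro x
    by_cases hx : lmarginal μ s f x = 0 <;> simp [hc, hx]
  · intro x y hxy
    simp [hc, Set.indicator, lmarginal_congr μ f hxy]

/-- For the density `ρ`, the conditional density of the `i`-th variable given those outside
`insert i s` rarely exceeds a large multiple of its conditional density given all other ones. -/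
theorem setLIntegral_lmarginal_ratio_le {ρ : (∀ i, E i) → ℝ≥0∞} (hρ : Measurable ρ)
    {s : Finset ι} {i : ι} (hi : i ∉ s) {K : ℝ≥0∞} (hK : K ≠ 0)
    (hKtop : K ≠ ∞) :
    ∫⁻ x in {x | K * (lmarginal μ (insert i s) ρ x * ρ x) <
        lmarginal μ s ρ x * lmarginal μ {i} ρ x}, ρ x ∂Measure.pi μ ≤
      K⁻¹ * ∫⁻ x, ρ x ∂Measure.pi μ := by
  set A := lmarginal μ (insert i s) ρ with hA
  set B := lmarginal μ s ρ with hB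
  set a := lmarginal μ {i} ρ with ha
  have hAm : Measurable A := hρ.lmarginal μ
  have hBm : Measurable B := hρ.lmarginal μ
  have ham : Measurable a := hρ.lmarginal μ
  have hmeas : MeasurableSet {x | K * (A x * ρ x) < B x * a x} :=
    measurableSet_lt ((hAm.mul hρ).const_mul K) (hBm.mul ham)
  have hae : ∀ᵐ x ∂Measure.pi μ, A x = 0 → ρ x = 0 := by
    have h0 := setLIntegral_lmarginal_eq_zero μ hρ (insert i s)
    rw [lintegral_eq_zero_iff hρ] at h0
    exact (ae_restrict_iff' (hAm (measurableSet_singleton 0))).mp h0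
  -- On the set `ρ ≤ K⁻¹ (B / A) a`. Neither `A` nor `B` depends on the variables in `s`, and
  -- integrating `a` over these gives `A`; what remains is at most `B`, the integral of `ρ` over the
  -- same variables.
  calc ∫⁻ x in {x | K * (A x * ρ x) < B x * a x}, ρ x ∂Measure.pi μ
      ≤ ∫⁻ x in {x | K * (A x * ρ x) < B x * a x}, K⁻¹ * (B x * (A x)⁻¹ * a x) ∂Measure.pi μ := by
        refine setLIntegral_mono_ae' hmeas ?_
        filter_upwards [hae] with x hx hlt
        have hlt : _ < _ := hlt
        rcases eq_or_ne (ρ x) 0 with h0 | h0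
        · rw [h0]; exact zero_le
        have hA0 : A x ≠ 0 := fun h => h0 (hx h)
        have hAt : A x ≠ ∞ := by
          intro h
          rw [h, ENNReal.top_mul h0, ENNReal.mul_top hK] at hlt
          exact not_top_lt hlt
        calc ρ x = K⁻¹ * (A x)⁻¹ * (K * (A x * ρ x)) := by
              rw [← mul_assoc K, ← mul_assoc, ← ENNReal.mul_inv (Or.inl hK) (Or.inl hKtop),
                ENNReal.inv_mul_cancel (mul_ne_zero hK hA0) (ENNReal.mul_ne_top hKtop hAt), one_mul]
          _ ≤ K⁻¹ * (A x)⁻¹ * (B x * a x) := by gcongr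
          _ = _ := by ring
    _ ≤ ∫⁻ x, K⁻¹ * (B x * (A x)⁻¹ * a x) ∂Measure.pi μ := setLIntegral_le_lintegral _ _
    _ = K⁻¹ * ∫⁻ x, B x * (A x)⁻¹ * a x ∂Measure.pi μ :=
        lintegral_const_mul' _ _ (ENNReal.inv_ne_top.mpr hK)
    _ ≤ K⁻¹ * ∫⁻ x, ρ x ∂Measure.pi μ := by
        refine mul_le_mul_right ?_ _
        refine lintegral_le_of_lmarginal_le s ((hBm.mul hAm.inv).mul ham) hρ ?_
        rw [lmarginal_mul_of_indep μ (c := fun x => B x * (A x)⁻¹) _ ham]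
        · intro x
          have : lmarginal μ s a x = A x := by
            rw [ha, ← lmarginal_union μ ρ hρ (Finset.disjoint_singleton_right.mpr hi), hA,
              Finset.insert_eq, Finset.union_comm]
          simp only [this, mul_assoc]
          exact mul_le_of_le_one_right zero_le (by
            rw [mul_comm]; exact ENNReal.mul_inv_le_one _)
        · intro x y hxy
          simp only [hA, hB]
          rw [lmarginal_congr μ ρ hxy, lmarginal_congr (s := insert i s) μ ρ fun j hj => hxy j (by
            simp only [Finset.mem_insert, not_or] at hj; exact hj.2)]

end Marginal

/-! ### Fubini for one distinguished coordinate -/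

section Slice

variable {ι : Type*} [DecidableEq ι] {E : ι → Type*}

theorem update_piSplitAt_symm (i : ι) (y w : E i) (x : ∀ j : {j // j ≠ i}, E j) :
    Function.update ((Equiv.piSplitAt i E).symm (y, x)) i w =
      (Equiv.piSplitAt i E).symm (w, x) := by
  ext j
  by_cases h : j = i
  · subst h; simp [Equiv.piSplitAt]
  · simp [Equiv.piSplitAt, h]

variable [∀ i, MeasurableSpace (E i)]

theorem lmarginal_singleton_piSplitAt_symm (μ : ∀ i, Measure (E i)) (i : ι)
    (g : (∀ i, E i) → ℝ≥0∞) (y : E i) (x : ∀ j : {j // j ≠ i}, E j) :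
    lmarginal μ {i} g ((Equiv.piSplitAt i E).symm (y, x)) =
      ∫⁻ w, g ((Equiv.piSplitAt i E).symm (w, x)) ∂μ i := by
  simp only [lmarginal_singleton, update_piSplitAt_symm]

theorem measurable_piSplitAt_symm (i : ι) : Measurable (Equiv.piSplitAt i E).symm := by
  refine measurable_pi_iff.mpr fun j => ?_
  by_cases h : j = i
  · subst h
    simpa [Equiv.piSplitAt] using measurable_fst
  · simp only [Equiv.piSplitAt, Equiv.coe_fn_symm_mk, h, dite_false]
    exact (measurable_pi_apply (⟨j, h⟩ : {j // j ≠ i})).comp measurable_snd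

variable [Fintype ι] (μ : ∀ i, Measure (E i)) [∀ i, SigmaFinite (μ i)]

instance sigmaFinite_restMeasure (i : ι) : SigmaFinite (restMeasure μ i) := by
  unfold restMeasure; infer_instance

theorem measurePreserving_piSplitAt_symm (i : ι) :
    MeasurePreserving (Equiv.piSplitAt i E).symm ((μ i).prod (restMeasure μ i))
      (Measure.pi μ) := by
  refine ⟨measurable_piSplitAt_symm i, (Measure.pi_eq fun s hs => ?_).symm⟩
  rw [Measure.map_apply (measurable_piSplitAt_symm i) (MeasurableSet.univ_pi hs)]
  have : (Equiv.piSplitAt i E).symm ⁻¹' Set.univ.pi s =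
      s i ×ˢ Set.univ.pi fun j : {j // j ≠ i} => s j := by
    ext ⟨y, x⟩
    simp only [Set.mem_preimage, Set.mem_univ_pi, Set.mem_prod]
    constructor
    · intro h
      refine ⟨by simpa [Equiv.piSplitAt] using h i, fun j => ?_⟩
      simpa [Equiv.piSplitAt, j.2] using h j
    · rintro ⟨h1, h2⟩ j
      by_cases h : j = i
      · subst h; simpa [Equiv.piSplitAt] using h1
      · simpa [Equiv.piSplitAt, h] using h2 ⟨j, h⟩
  rw [this, Measure.prod_prod, restMeasure, Measure.pi_pi]
  exact (Fintype.prod_eq_mul_prod_subtype_ne (fun j => μ j (s j)) i).symm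

theorem lintegral_pi_eq_lintegral_slice (i : ι) {g : (∀ i, E i) → ℝ≥0∞} (hg : Measurable g) :
    ∫⁻ z, g z ∂Measure.pi μ =
      ∫⁻ x, ∫⁻ y, g ((Equiv.piSplitAt i E).symm (y, x)) ∂μ i ∂restMeasure μ i := by
  rw [← (measurePreserving_piSplitAt_symm μ i).lintegral_comp hg]
  exact lintegral_prod_symm _ (hg.comp (measurable_piSplitAt_symm i)).aemeasurable

end Slice

/-! ### Tail estimates for sections -/

section Product

theorem SymmDirichletForm.onFun_self {Ω : Type*} [MeasurableSpace Ω] {μ : Measure Ω}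
    (ℰ : SymmDirichletForm μ) {g : Ω → ℝ} (h : MemLp g 2 μ) (hg : h.toLp g ∈ ℰ.domain) :
    ℰ.onFun g g = ℰ.form ⟨h.toLp g, hg⟩ ⟨h.toLp g, hg⟩ := by
  have : ℰ.MemDomain g := ⟨h, hg⟩
  rw [onFun, dif_pos ⟨this, this⟩]

theorem SymmDirichletForm.onFun_self_nonneg {Ω : Type*} [MeasurableSpace Ω] {μ : Measure Ω}
    (ℰ : SymmDirichletForm μ) (g : Ω → ℝ) : 0 ≤ ℰ.onFun g g := by
  by_cases h : ℰ.MemDomain g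
  · obtain ⟨h, hg⟩ := h
    rw [ℰ.onFun_self h hg]
    exact ℰ.nonneg _
  · simp [onFun, h]

theorem SymmDirichletForm.lintegral_tail_onFun_le {Ω : Type*} [MeasurableSpace Ω] {μ : Measure Ω}
    (ℰ : SymmDirichletForm μ) {β : ℝ → ℝ}
    (hSP : SuperPoincare μ ℰ.domain (fun f g => ℰ.form f g) β) {s T : ℝ} (hs : 0 < s)
    (hβ : 0 ≤ β s) (hT : 0 < T) {g : Ω → ℝ} (hg : ℰ.MemDomain g) :
    ∫⁻ x, (Set.Ioi (ENNReal.ofReal T * ∫⁻ y, ‖g y‖ₑ ^ 2 ∂μ)).indicator id (‖g x‖ₑ ^ 2) ∂μ ≤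
      ENNReal.ofReal (4 * s * ℰ.onFun g g) +
        ENNReal.ofReal (16 * β s / T) * ∫⁻ y, ‖g y‖ₑ ^ 2 ∂μ := by
  obtain ⟨h, hg⟩ := hg
  have hae := h.coeFn_toLp
  have key := ℰ.lintegral_tail_le hSP hs hβ hT ⟨h.toLp g, hg⟩
  have h1 : ∫⁻ y, ‖h.toLp g y‖ₑ ^ 2 ∂μ = ∫⁻ y, ‖g y‖ₑ ^ 2 ∂μ :=
    lintegral_congr_ae (by filter_upwards [hae] with x hx; rw [hx])
  simp only [h1] at key
  rw [ℰ.onFun_self h hg]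
  refine le_trans (le_of_eq ?_) key
  rw [← lintegral_indicator (measurableSet_lt measurable_const
    ((Lp.stronglyMeasurable _).enorm.pow_const 2))]
  refine lintegral_congr_ae ?_
  filter_upwards [hae] with x hx
  simp [Set.indicator, hx]

variable {N : ℕ} {E : Fin N → Type*} [∀ i, MeasurableSpace (E i)]
  {μ : ∀ i, Measure (E i)} [∀ i, SigmaFinite (μ i)]

/-- On each fibre `lmarginal μ {i}` of `f²` is constant, equal to the squared `L²` norm of the
section, so the one-variable tail bound applies fibrewise and integrates. -/
theorem lintegral_slice_tail_le (ℰ : ∀ i, SymmDirichletForm (μ i)) (i : Fin N) {β : ℝ → ℝ}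
    (hSP : SuperPoincare (μ i) (ℰ i).domain (fun f g => (ℰ i).form f g) β) {s T : ℝ}
    (hs : 0 < s) (hβ : 0 ≤ β s) (hT : 0 < T) (f : prodDomain ℰ) :
    ∫⁻ z in {z | ENNReal.ofReal T *
          lmarginal μ {i} (fun z => ‖(f : Lp ℝ 2 (Measure.pi μ)) z‖ₑ ^ 2) z <
          ‖(f : Lp ℝ 2 (Measure.pi μ)) z‖ₑ ^ 2},
        ‖(f : Lp ℝ 2 (Measure.pi μ)) z‖ₑ ^ 2 ∂Measure.pi μ ≤
      ENNReal.ofReal (4 * s * ∫ x, (ℰ i).onFun (sliceAt (f : Lp ℝ 2 (Measure.pi μ)) i x)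
        (sliceAt (f : Lp ℝ 2 (Measure.pi μ)) i x) ∂restMeasure μ i) +
        ENNReal.ofReal (16 * β s / T) *
          ∫⁻ z, ‖(f : Lp ℝ 2 (Measure.pi μ)) z‖ₑ ^ 2 ∂Measure.pi μ := by
  set ρ : (∀ i, E i) → ℝ≥0∞ := fun z => ‖(f : Lp ℝ 2 (Measure.pi μ)) z‖ₑ ^ 2 with hρ_def
  have hρ : Measurable ρ := (Lp.stronglyMeasurable _).enorm.pow_const 2
  have hm : MeasurableSet {z | ENNReal.ofReal T * lmarginal μ {i} ρ z < ρ z} :=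
    measurableSet_lt ((hρ.lmarginal μ).const_mul _) hρ
  have hint := (f.2 i).2
  calc ∫⁻ z in {z | ENNReal.ofReal T * lmarginal μ {i} ρ z < ρ z}, ρ z ∂Measure.pi μ
      = ∫⁻ x, ∫⁻ y, {z | ENNReal.ofReal T * lmarginal μ {i} ρ z < ρ z}.indicator ρ
          ((Equiv.piSplitAt i E).symm (y, x)) ∂μ i ∂restMeasure μ i := by
        rw [← lintegral_indicator hm, lintegral_pi_eq_lintegral_slice μ i (hρ.indicator hm)]
    _ ≤ ∫⁻ x, (ENNReal.ofReal (4 * s * (ℰ i).onFun (sliceAt (f : Lp ℝ 2 (Measure.pi μ)) i x)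
          (sliceAt (f : Lp ℝ 2 (Measure.pi μ)) i x)) + ENNReal.ofReal (16 * β s / T) *
          ∫⁻ y, ρ ((Equiv.piSplitAt i E).symm (y, x)) ∂μ i) ∂restMeasure μ i := by
        refine lintegral_mono_ae ?_
        filter_upwards [(f.2 i).1] with x hx
        refine le_trans (le_of_eq ?_) ((ℰ i).lintegral_tail_onFun_le hSP hs hβ hT hx)
        refine lintegral_congr fun y => ?_
        simp only [Set.indicator, Set.mem_ofPred_eq, lmarginal_singleton_piSplitAt_symm,
          Set.mem_Ioi]
        rfl
    _ = _ := by
        rw [lintegral_add_right, lintegral_const_mul, ← lintegral_pi_eq_lintegral_slice μ i hρ,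
          ← ofReal_integral_eq_lintegral_ofReal (hint.const_mul _), integral_const_mul]
        · exact ae_of_all _ fun x => mul_nonneg (by positivity) ((ℰ i).onFun_self_nonneg _)
        · exact (hρ.comp (measurable_piSplitAt_symm i)).lintegral_prod_left'
        · exact ((hρ.comp (measurable_piSplitAt_symm i)).lintegral_prod_left').const_mul _

/-! ### Telescoping and tensorization -/

/-- Telescoping the marginals of `ρ` over an increasing family of sets of variables. -/
theorem le_prod_mul_lintegral_of_lmarginal {ρ : (∀ i, E i) → ℝ≥0∞} {C : Fin N → ℝ≥0∞}
    {x : ∀ i, E i}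
    (h : ∀ i, lmarginal μ (Finset.univ.filter (· < i)) ρ x ≤
      C i * lmarginal μ (insert i (Finset.univ.filter (· < i))) ρ x) :
    ρ x ≤ (∏ i, C i) * ∫⁻ z, ρ z ∂Measure.pi μ := by
  have key : ∀ n : ℕ, n ≤ N → ρ x ≤ (∏ i with i.val < n, C i) *
      lmarginal μ (Finset.univ.filter fun i : Fin N => i.val < n) ρ x := by
    intro n
    induction n with
    | zero => intro _; simp
    | succ n ih =>
      intro hn
      have hi := h ⟨n, hn⟩
      have e0 : (Finset.univ.filter (· < (⟨n, hn⟩ : Fin N))) =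
          Finset.univ.filter fun i : Fin N => i.val < n := by
        ext j; simp [Fin.lt_def]
      have e1 : (Finset.univ.filter fun i : Fin N => i.val < n + 1) =
          insert ⟨n, hn⟩ (Finset.univ.filter fun i : Fin N => i.val < n) := by
        ext j; simp [Fin.ext_iff]; omega
      rw [e0] at hi
      rw [e1, Finset.prod_insert (by simp)]
      refine (ih (by omega)).trans ?_
      calc _ ≤ (∏ i with i.val < n, C i) * (C ⟨n, hn⟩ * _) := mul_le_mul_right hi _
        _ = _ := by ring
  have hN := key N le_rfl
  simpa using hN

/-- AM-GM bounds the last term by `F / 4 + M * L ^ 2`; the total coefficient of `F` on the right is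
then at most `9 / 16` and is absorbed. -/
theorem real_bound_of_split {F I L M δN NK : ℝ} (hF : 0 ≤ F) (hM : 0 ≤ M) (hδ : δN ≤ 1 / 16)
    (hNK : NK ≤ 1 / 4) (h : F ≤ I / 4 + δN * F + NK * F + √(M * F) * L) :
    F ≤ I + 4 * M * L ^ 2 := by
  have h1 : √(M * F) * L ≤ F / 4 + M * L ^ 2 := by
    rw [Real.sqrt_mul hM]
    nlinarith [sq_nonneg (√F / 2 - √M * L), Real.sq_sqrt hF, Real.sq_sqrt hM]
  have h2 := mul_le_mul_of_nonneg_right hδ hF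
  have h3 := mul_le_mul_of_nonneg_right hNK hF
  have h4 : 0 ≤ M * L ^ 2 := by positivity
  linarith

/-- Super Poincaré inequalities tensorize, up to constants, with the product of the rates. -/
theorem superPoincare_pi (ℰ : ∀ i, SymmDirichletForm (μ i)) (β : Fin N → ℝ → ℝ)
    (hβ : ∀ i r, 0 < r → 0 < β i r)
    (hSP : ∀ i, SuperPoincare (μ i) (ℰ i).domain (fun f g => (ℰ i).form f g) (β i)) :
    SuperPoincare (Measure.pi μ) (prodDomain ℰ) (prodForm ℰ)
      (fun r => 4 * ∏ i, (1024 * (N + 1) ^ 2 * β i (r / (16 * (N + 1))))) := by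
  intro r hr f
  set ρ : (∀ i, E i) → ℝ≥0∞ := fun z => ‖(f : Lp ℝ 2 (Measure.pi μ)) z‖ₑ ^ 2 with hρ_def
  have hρ : Measurable ρ := (Lp.stronglyMeasurable _).enorm.pow_const 2
  have hρtop : ∀ z, ρ z ≠ ∞ := fun z => by simp [hρ_def]
  have hn : (0 : ℝ) < N + 1 := by positivity
  -- The constants make the energy terms sum to at most `r ℰ(f, f) / 4`, and the mass terms to at
  -- most `F / 16` from the sets `U i` and `F / 4` from the `V i`. Using `N + 1` keeps the
  -- denominators positive when `N = 0`.
  set s : ℝ := r / (16 * (N + 1)) with hs_def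
  have hs : 0 < s := by positivity
  set T : Fin N → ℝ := fun i => 256 * (N + 1) * β i s with hT_def
  have hT : ∀ i, 0 < T i := fun i => mul_pos (by positivity) (hβ i s hs)
  set M : ℝ := ∏ i, (1024 * (N + 1) ^ 2 * β i s) with hM_def
  have hM : 0 < M := Finset.prod_pos fun i _ => mul_pos (by positivity) (hβ i s hs)
  set K : ℝ := 4 * (N + 1) with hK_def
  have hK : 0 < K := by positivity
  have hKT : ∀ i, K * T i = 1024 * (N + 1) ^ 2 * β i s := fun i => by
    simp only [hK_def, hT_def]; ring
  have hFtop : ∫⁻ z, ρ z ∂Measure.pi μ ≠ ∞ := lintegral_enorm_sq_Lp_ne_top _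
  set F := (∫⁻ z, ρ z ∂Measure.pi μ).toReal
  have hFe : ∫⁻ z, ρ z ∂Measure.pi μ = ENNReal.ofReal F :=
    (ENNReal.ofReal_toReal hFtop).symm
  have hF : 0 ≤ F := ENNReal.toReal_nonneg
  rcases eq_or_ne (∫⁻ z, ‖(f : Lp ℝ 2 (Measure.pi μ)) z‖ₑ ∂Measure.pi μ) ∞ with hL | hLtop
  · rw [hL, ENNReal.top_pow two_ne_zero, ENNReal.mul_top, add_top]
    · exact le_top
    · simpa using hM
  set L := (∫⁻ z, ‖(f : Lp ℝ 2 (Measure.pi μ)) z‖ₑ ∂Measure.pi μ).toReal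
  have hLe : ∫⁻ z, ‖(f : Lp ℝ 2 (Measure.pi μ)) z‖ₑ ∂Measure.pi μ = ENNReal.ofReal L :=
    (ENNReal.ofReal_toReal hLtop).symm
  have hL : 0 ≤ L := ENNReal.toReal_nonneg
  set e : Fin N → ℝ := fun i => ∫ x, (ℰ i).onFun (sliceAt (f : Lp ℝ 2 (Measure.pi μ)) i x)
    (sliceAt (f : Lp ℝ 2 (Measure.pi μ)) i x) ∂restMeasure μ i with he_def
  have he : ∀ i, 0 ≤ e i := fun i => integral_nonneg fun x => (ℰ i).onFun_self_nonneg _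
  have hform : prodForm ℰ f f = ∑ i, e i := rfl
  set U : Fin N → Set (∀ i, E i) :=
    fun i => {z | ENNReal.ofReal (T i) * lmarginal μ {i} ρ z < ρ z} with hU_def
  set V : Fin N → Set (∀ i, E i) := fun i => {z | ENNReal.ofReal K *
      (lmarginal μ (insert i (Finset.univ.filter (· < i))) ρ z * ρ z) <
      lmarginal μ (Finset.univ.filter (· < i)) ρ z * lmarginal μ {i} ρ z} with hV_def
  have hU : ∀ i, ∫⁻ z in U i, ρ z ∂Measure.pi μ ≤
      ENNReal.ofReal (4 * s * e i + 1 / (16 * (N + 1)) * F) := fun i => by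
    refine (lintegral_slice_tail_le ℰ i (hSP i) hs (hβ i s hs).le (hT i) f).trans_eq ?_
    rw [hFe, ← ENNReal.ofReal_mul (div_nonneg (mul_nonneg (by norm_num) (hβ i s hs).le) (hT i).le),
      ← ENNReal.ofReal_add (mul_nonneg (by positivity) (he i)) (mul_nonneg
        (div_nonneg (mul_nonneg (by norm_num) (hβ i s hs).le) (hT i).le) hF)]
    have := (hβ i s hs).ne'
    congr 3
    simp only [hT_def]
    field_simp
    norm_num
  have hV : ∀ i, ∫⁻ z in V i, ρ z ∂Measure.pi μ ≤ ENNReal.ofReal (K⁻¹ * F) := fun i => by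
    refine (setLIntegral_lmarginal_ratio_le μ hρ (by simp)
      (ENNReal.ofReal_pos.mpr hK).ne' ENNReal.ofReal_ne_top).trans_eq ?_
    rw [hFe, ← ENNReal.ofReal_inv_of_pos hK, ← ENNReal.ofReal_mul (by positivity)]
  have hG : ∀ z, z ∉ (⋃ i, U i) ∪ ⋃ i, V i → ρ z ≤
      ENNReal.ofReal √(M * F) * ‖(f : Lp ℝ 2 (Measure.pi μ)) z‖ₑ := by
    intro z hz
    simp only [Set.mem_union, Set.mem_iUnion, not_or, not_exists, hU_def, hV_def,
      Set.mem_ofPred_eq, not_lt] at hz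
    obtain ⟨hz1, hz2⟩ := hz
    rcases eq_or_ne (ρ z) 0 with h0 | h0
    · rw [h0]; exact zero_le
    have hle : ρ z ≤ ENNReal.ofReal (M * F) := by
      have := le_prod_mul_lintegral_of_lmarginal (μ := μ) (ρ := ρ) (x := z)
        (C := fun i => ENNReal.ofReal (K * T i)) fun i => by
          -- After multiplication by `ρ z`, failure of `U i` and then of `V i` can be chained,
          -- eliminating the marginal in the `i`-th variable.
          refine (ENNReal.mul_le_mul_iff_left h0 (hρtop z)).mp ?_
          calc lmarginal μ (Finset.univ.filter (· < i)) ρ z * ρ z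
              ≤ lmarginal μ (Finset.univ.filter (· < i)) ρ z *
                (ENNReal.ofReal (T i) * lmarginal μ {i} ρ z) := by gcongr; exact hz1 i
            _ = ENNReal.ofReal (T i) * (lmarginal μ (Finset.univ.filter (· < i)) ρ z *
                lmarginal μ {i} ρ z) := by ring
            _ ≤ ENNReal.ofReal (T i) * (ENNReal.ofReal K *
                (lmarginal μ (insert i (Finset.univ.filter (· < i))) ρ z * ρ z)) := by
                exact mul_le_mul_right (hz2 i) _
            _ = _ := by rw [ENNReal.ofReal_mul hK.le]; ring
      rw [hFe, ← ENNReal.ofReal_prod_of_nonneg fun i _ => (mul_pos hK (hT i)).le,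
        ← ENNReal.ofReal_mul (Finset.prod_nonneg fun i _ => (mul_pos hK (hT i)).le)] at this
      simpa only [hKT] using this
    have hnorm : ‖(f : Lp ℝ 2 (Measure.pi μ)) z‖ₑ ≤ ENNReal.ofReal √(M * F) := by
      refine (ENNReal.pow_le_pow_left_iff two_ne_zero).mp ?_
      rw [← ENNReal.ofReal_pow (Real.sqrt_nonneg _), Real.sq_sqrt (by positivity)]
      exact hle
    simp only [hρ_def, sq]
    gcongr
  have hUm : MeasurableSet ((⋃ i, U i) ∪ ⋃ i, V i) :=
    (MeasurableSet.iUnion fun i => measurableSet_lt ((hρ.lmarginal μ).const_mul _) hρ).union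
      (MeasurableSet.iUnion fun i => measurableSet_lt (((hρ.lmarginal μ).mul hρ).const_mul _)
        ((hρ.lmarginal μ).mul (hρ.lmarginal μ)))
  have hsum : ENNReal.ofReal F ≤ ENNReal.ofReal (4 * s * prodForm ℰ f f +
      (N / (16 * (N + 1))) * F + (N / (4 * (N + 1))) * F + √(M * F) * L) := by
    calc ENNReal.ofReal F = ∫⁻ z, ρ z ∂Measure.pi μ := hFe.symm
      _ = ∫⁻ z in (⋃ i, U i) ∪ ⋃ i, V i, ρ z ∂Measure.pi μ +
          ∫⁻ z in ((⋃ i, U i) ∪ ⋃ i, V i)ᶜ, ρ z ∂Measure.pi μ := (lintegral_add_compl _ hUm).symm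
      _ ≤ (∑ i, ENNReal.ofReal (4 * s * e i + 1 / (16 * (N + 1)) * F) +
            ∑ _i : Fin N, ENNReal.ofReal (K⁻¹ * F)) +
          ENNReal.ofReal (√(M * F) * L) := by
        gcongr
        · refine (lintegral_union_le _ _ _).trans (add_le_add ?_ ?_)
          · refine (lintegral_iUnion_le _ _).trans ?_
            rw [tsum_fintype]
            exact Finset.sum_le_sum fun i _ => hU i
          · refine (lintegral_iUnion_le _ _).trans ?_
            rw [tsum_fintype]
            exact Finset.sum_le_sum fun i _ => hV i
        · calc _ ≤ ∫⁻ z in ((⋃ i, U i) ∪ ⋃ i, V i)ᶜ, ENNReal.ofReal √(M * F) *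
                ‖(f : Lp ℝ 2 (Measure.pi μ)) z‖ₑ ∂Measure.pi μ :=
                setLIntegral_mono' hUm.compl fun z hz => hG z hz
            _ ≤ ∫⁻ z, ENNReal.ofReal √(M * F) *
                ‖(f : Lp ℝ 2 (Measure.pi μ)) z‖ₑ ∂Measure.pi μ := setLIntegral_le_lintegral _ _
            _ = _ := by
              rw [lintegral_const_mul' _ _ (by simp), hLe, ENNReal.ofReal_mul (Real.sqrt_nonneg _)]
      _ = _ := by
        have h1 : ∀ i, 0 ≤ 4 * s * e i + 1 / (16 * (N + 1)) * F := fun i =>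
          add_nonneg (mul_nonneg (by positivity) (he i)) (by positivity)
        have h2 : 0 ≤ K⁻¹ * F := by positivity
        rw [← ENNReal.ofReal_sum_of_nonneg fun i _ => h1 i,
          ← ENNReal.ofReal_sum_of_nonneg fun i _ => h2,
          ← ENNReal.ofReal_add (Finset.sum_nonneg fun i _ => h1 i) (Finset.sum_nonneg fun i _ => h2),
          ← ENNReal.ofReal_add (add_nonneg (Finset.sum_nonneg fun i _ => h1 i)
            (Finset.sum_nonneg fun i _ => h2)) (by positivity), hform, Finset.sum_add_distrib,
          ← Finset.mul_sum]
        congr 1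
        simp only [Finset.sum_const, Finset.card_univ, Fintype.card_fin, nsmul_eq_mul, hK_def,
          hs_def]
        field_simp
  have hE : 0 ≤ prodForm ℰ f f := hform ▸ Finset.sum_nonneg fun i _ => he i
  rw [ENNReal.ofReal_le_ofReal_iff (by positivity)] at hsum
  have hsr : 4 * s * prodForm ℰ f f ≤ r * prodForm ℰ f f / 4 := by
    rw [mul_div_right_comm]
    refine mul_le_mul_of_nonneg_right ?_ hE
    rw [hs_def, ← mul_div_assoc, div_le_div_iff₀ (by positivity) (by norm_num)]
    nlinarith [mul_nonneg hr.le (Nat.cast_nonneg (α := ℝ) N)]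
  have hδN : N / (16 * (N + 1)) ≤ (1 / 16 : ℝ) := by
    rw [div_le_div_iff₀ (by positivity) (by norm_num)]; linarith
  have hNK : N / (4 * (N + 1)) ≤ (1 / 4 : ℝ) := by
    rw [div_le_div_iff₀ (by positivity) (by norm_num)]; linarith
  have := real_bound_of_split (I := r * prodForm ℰ f f) (L := L) hF hM.le hδN hNK (by linarith)
  change ∫⁻ z, ρ z ∂Measure.pi μ ≤ _
  rw [hFe, hLe, ← ENNReal.ofReal_pow hL, ← ENNReal.ofReal_mul (by positivity),
    ← ENNReal.ofReal_add (by positivity) (by positivity)]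
  apply ENNReal.ofReal_le_ofReal
  linarith

/-! ### Polynomial rates -/

theorem SuperPoincare.mono {Ω : Type*} [MeasurableSpace Ω] {μ : Measure Ω} {D : Set (Lp ℝ 2 μ)}
    {ℰ : D → D → ℝ} {β γ : ℝ → ℝ} (h : SuperPoincare μ D ℰ β) (hβ : ∀ r, 0 < r → β r ≤ γ r) :
    SuperPoincare μ D ℰ γ := fun r hr f =>
  (h r hr f).trans (by gcongr; exact hβ r hr)

/-- Each factor is at most `2 * r ^ (-p i)` if `r ≤ 1` and at most `2` if `r ≥ 1`. -/
theorem prod_one_add_rpow_neg_le {ι : Type*} (s : Finset ι) {p : ι → ℝ} (hp : ∀ i, 0 ≤ p i)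
    {r : ℝ} (hr : 0 < r) :
    ∏ i ∈ s, (1 + r ^ (-p i)) ≤ 2 ^ s.card * (1 + r ^ (-∑ i ∈ s, p i)) := by
  rcases le_total r 1 with h | h
  · calc ∏ i ∈ s, (1 + r ^ (-p i)) ≤ ∏ i ∈ s, (2 * r ^ (-p i)) := by
          refine Finset.prod_le_prod (fun i _ => by positivity) fun i _ => ?_
          linarith [Real.one_le_rpow_of_pos_of_le_one_of_nonpos hr h (neg_nonpos.mpr (hp i))]
      _ = 2 ^ s.card * r ^ (-∑ i ∈ s, p i) := by
          rw [Finset.prod_mul_distrib, Finset.prod_const, ← Finset.sum_neg_distrib,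
            Real.rpow_sum_of_pos hr]
      _ ≤ _ := by gcongr; linarith
  · calc ∏ i ∈ s, (1 + r ^ (-p i)) ≤ ∏ i ∈ s, (2 : ℝ) := by
          refine Finset.prod_le_prod (fun i _ => by positivity) fun i _ => ?_
          linarith [Real.rpow_le_one_of_one_le_of_nonpos h (neg_nonpos.mpr (hp i))]
      _ = 2 ^ s.card * 1 := by simp
      _ ≤ _ := by gcongr; linarith [Real.rpow_nonneg hr.le (-∑ i ∈ s, p i)]

end Product

theorem proposition2p2 {N : ℕ} {E : Fin N → Type*} [∀ i, MeasurableSpace (E i)]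
    (μ : ∀ i, Measure (E i)) [∀ i, SigmaFinite (μ i)]
    (ℰ : ∀ i, SymmDirichletForm (μ i))
    (p : Fin N → ℝ) (hp : ∀ i, 0 < p i)
    (hSP : ∀ i, ∃ c : ℝ, 0 < c ∧
      SuperPoincare (μ i) (ℰ i).domain (fun f g => (ℰ i).form f g)
        (fun r => c * (1 + r ^ (-p i)))) :
    ∃ c : ℝ, 0 < c ∧
      SuperPoincare (Measure.pi μ) (prodDomain ℰ) (prodForm ℰ)
        (fun r => c * (1 + r ^ (-∑ i, p i))) := by
  choose c hc hSP using hSP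
  set a : ℝ := 16 * (N + 1) with ha_def
  have ha : 0 < a := by positivity
  have ha1 : 1 ≤ a := by rw [ha_def]; linarith [Nat.cast_nonneg (α := ℝ) N]
  set A : ℝ := ∏ i, (1024 * (N + 1) ^ 2 * c i * a ^ p i) with hA_def
  have hA : 0 < A := Finset.prod_pos fun i _ => mul_pos
    (mul_pos (by positivity) (hc i)) (Real.rpow_pos_of_pos ha _)
  refine ⟨4 * A * 2 ^ N, by positivity, ?_⟩
  refine (superPoincare_pi ℰ (fun i r => c i * (1 + r ^ (-p i)))
    (fun i r hr => mul_pos (hc i) (by positivity)) hSP).mono fun r hr => ?_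
  -- Rescaling `r` by `a ≥ 1` costs only the constant `a ^ p i` in each factor.
  calc 4 * ∏ i, (1024 * (N + 1 : ℝ) ^ 2 * (c i * (1 + (r / a) ^ (-p i))))
      ≤ 4 * ∏ i, (1024 * (N + 1 : ℝ) ^ 2 * c i * a ^ p i * (1 + r ^ (-p i))) := by
        refine mul_le_mul_of_nonneg_left (Finset.prod_le_prod (fun i _ => ?_) fun i _ => ?_)
          (by norm_num)
        · have := (hc i).le
          positivity
        · have h1 : (r / a) ^ (-p i) = a ^ p i * r ^ (-p i) := by
            rw [Real.div_rpow hr.le ha.le, Real.rpow_neg ha.le, div_inv_eq_mul, mul_comm]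
          have h2 : 1 ≤ a ^ p i := Real.one_le_rpow ha1 (hp i).le
          have := (hc i).le
          rw [h1, ← mul_assoc, mul_assoc _ (a ^ p i)]
          refine mul_le_mul_of_nonneg_left ?_ (by positivity)
          linarith
    _ = 4 * (A * ∏ i, (1 + r ^ (-p i))) := by rw [Finset.prod_mul_distrib]
    _ ≤ 4 * (A * (2 ^ N * (1 + r ^ (-∑ i, p i)))) := by
        gcongr
        simpa using prod_one_add_rpow_neg_le Finset.univ (fun i => (hp i).le) hr
    _ = _ := by ring
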